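/- Let $r,n\ge 1$ be integers and let $\omega\in\mathbb C$ be a primitive $r$-th root of unity. Let $G(r,n)=C_r\wr S_n$ be the group of colored permutations $\pi=\sigma_1^{[z_1]}\cdots\sigma_n^{[z_n]}$, where $\sigma\in S_n$ and $z_1,\dots,z_n\in\{0,\dots,r-1\}$ (representing $\mathbb Z/r$). Such a $\pi$ acts by $\pi(\omega^c i)=\omega^{c+z_i}\sigma_i$, the product is composition of maps, and we write $\pi_i=\pi(i)=\omega^{z_i}\sigma_i$ and $|\pi_i|=\sigma_i$. Let $\ell(\pi)$ be the minimum number of factors in an expression of $\pi$ as a product of the generators $s_0,s_1,\dots,s_{n-1}$, where $s_0$ maps $1$ to $\omega\cdot 1$ and fixes $2,\dots,n$, and $s_i=(i,i+1)$ for $1\le i\le n-1$. Let $$\mathsf{lmaj}(\pi)=\sum_{1\le i<n,\ \pi_i>\pi_{i+1}} i\;+\sum_{i:\,z_i>0}(|\pi_i|+z_i-1)$$ be Bagno's statistic, where the descents $\pi_i>\pi_{i+1}$ are taken with respect to the linear order $$(n^{[r-1]}<\cdots<n^{[1]})<\cdots<(1^{[r-1]}<\cdots<1^{[1]})<(1<\cdots<n).$$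 Write $[k]_x=1+x+\cdots+x^{k-1}$ (so $[0]_x=0$). For $a\in\{0,1\}$ and $b\in\{0,1,\dots,r-1\}$ put $$\chi_{a,b}(\pi)=(-1)^{a(\ell(\pi)-\sum z_i)}\,\omega^{b\sum z_i}.$$ Each $\chi_{a,b}$ is a 1-dimensional character $G(r,n)\to\mathbb C^\times$, every 1-dimensional character of $G(r,n)$ is one of the $\chi_{a,b}$, and for all $a\in\{0,1\}$, $b\in\{0,1,\dots,r-1\}$ the following identities hold in $\mathbb C[q]$: $$\sum_{\pi\in G(r,n)} \chi_{a,b}(\pi)q^{\ell(\pi)}=\prod_{k=1}^n[k]_{(-1)^aq}\left(1+(-1)^{a(k+1)}\omega^bq^k[r-1]_{\omega^bq}\right),$$ $$\sum_{\pi\in G(r,n)} \chi_{a,b}(\pi)q^{\mathsf{lmaj}(\pi)}=\prod_{k=1}^n[k]_{(-1)^{a(k-1)}q}\left(1+(-1)^{a(k+1)}\omega^bq^k[r-1]_{\omega^bq}\right).$$ -/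

import Mathlib

/-- A colored permutation of `n` digits with `r` colors, in window notation
`σ₁^[z₁] σ₂^[z₂] ⋯ σₙ^[zₙ]`: the color `z i` is attached to the position `i`, that is,
`π i = ω ^ (z i) * σ i`.  Positions and digits are indexed by `Fin n`, so `i : Fin n` stands
for the digit `i + 1`. -/
@[ext]
structure ColoredPerm (r n : ℕ) where
  z : Fin n → ZMod r
  σ : Equiv.Perm (Fin n)

namespace ColoredPerm

variable {r n : ℕ}

/-- The colored permutation as a self-map of the colored digits `ω ^ c * i`, written `(i, c)`:
`π (ω ^ c * i) = ω ^ c * π i = ω ^ (c + z i) * σ i`. -/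
def act (π : ColoredPerm r n) (x : Fin n × ZMod r) : Fin n × ZMod r :=
  (π.σ x.1, x.2 + π.z x.1)

/-- The product is composition of maps, `(π * τ) i = π (τ i)`; see `act_mul`. -/
instance : Mul (ColoredPerm r n) :=
  ⟨fun π τ => ⟨fun i => τ.z i + π.z (τ.σ i), π.σ * τ.σ⟩⟩

instance : One (ColoredPerm r n) := ⟨⟨fun _ => 0, 1⟩⟩

instance : Inv (ColoredPerm r n) :=
  ⟨fun π => ⟨fun i => - π.z (π.σ⁻¹ i), π.σ⁻¹⟩⟩

theorem mul_z (π τ : ColoredPerm r n) (i : Fin n) : (π * τ).z i = τ.z i + π.z (τ.σ i) := rfl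

theorem mul_σ (π τ : ColoredPerm r n) : (π * τ).σ = π.σ * τ.σ := rfl

theorem one_z (i : Fin n) : (1 : ColoredPerm r n).z i = 0 := rfl

theorem one_σ : (1 : ColoredPerm r n).σ = 1 := rfl

theorem inv_z (π : ColoredPerm r n) (i : Fin n) : (π⁻¹).z i = - π.z (π.σ⁻¹ i) := rfl

theorem inv_σ (π : ColoredPerm r n) : (π⁻¹).σ = π.σ⁻¹ := rfl

/-- The group `G(r,n)`, the wreath product of the cyclic group `C_r` with `S_n`. -/
instance : Group (ColoredPerm r n) :=
  Group.ofLeftAxioms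
    (fun a b c => by
      apply ColoredPerm.ext
      · funext i
        simp only [mul_z, mul_σ, Equiv.Perm.mul_apply, add_assoc]
      · simp only [mul_σ, mul_assoc])
    (fun a => by
      apply ColoredPerm.ext
      · funext i
        simp only [mul_z, one_z, add_zero]
      · simp only [mul_σ, one_σ, one_mul])
    (fun a => by
      apply ColoredPerm.ext
      · funext i
        simp [mul_z, inv_z, one_z]
      · simp only [mul_σ, inv_σ, one_σ, inv_mul_cancel])

theorem act_mul (π τ : ColoredPerm r n) (x : Fin n × ZMod r) :
    act (π * τ) x = act π (act τ x) := by
  simp only [act, mul_z, mul_σ, Equiv.Perm.mul_apply, add_assoc]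

/-- A colored permutation is the same as a pair `(z, σ)`. -/
def equivProd : ColoredPerm r n ≃ (Fin n → ZMod r) × Equiv.Perm (Fin n) where
  toFun π := (π.z, π.σ)
  invFun p := ⟨p.1, p.2⟩
  left_inv _ := rfl
  right_inv _ := rfl

instance [NeZero r] : Fintype (ColoredPerm r n) := Fintype.ofEquiv _ equivProd.symm

/-- The generators: `s₀` colors the digit `1` with `ω` and fixes the other digits, and
`sᵢ = (i, i+1)` for `i = 1, …, n - 1` (with digits shifted by one in `Fin n`, the transposition
of `i - 1` and `i`). -/
def gen (i : Fin n) : ColoredPerm r n :=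
  if (i : ℕ) = 0 then ⟨fun j => if (j : ℕ) = 0 then 1 else 0, 1⟩
  else ⟨fun _ => 0, Equiv.swap ⟨(i : ℕ) - 1, lt_of_le_of_lt (Nat.sub_le _ _) i.isLt⟩ i⟩

/-- The length of `π`: the minimum number of generators `s₀, …, sₙ₋₁` (with repetition, inverses
not allowed) whose product is `π`. -/
noncomputable def length (π : ColoredPerm r n) : ℕ :=
  sInf {k : ℕ | ∃ w : List (Fin n), w.length = k ∧ (w.map gen).prod = π}

/-- The strict linear order on colored digits `(i, c)`, meaning `i^[c]`,
`(n^[r-1] < ⋯ < n^[1]) < ⋯ < (1^[r-1] < ⋯ < 1^[1]) < (1 < ⋯ < n)`. -/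
def letterLT (x y : Fin n × ZMod r) : Prop :=
  (x.2 = 0 ∧ y.2 = 0 ∧ x.1 < y.1) ∨
  (x.2 ≠ 0 ∧ y.2 = 0) ∨
  (x.2 ≠ 0 ∧ y.2 ≠ 0 ∧ (y.1 < x.1 ∨ (x.1 = y.1 ∧ y.2.val < x.2.val)))

instance (x y : Fin n × ZMod r) : Decidable (letterLT x y) := by
  unfold letterLT; infer_instance

/-- The `i`-th letter of the window notation of `π`. -/
def letter (π : ColoredPerm r n) (i : Fin n) : Fin n × ZMod r := (π.σ i, π.z i)

/-- The major index `maj_A`: the sum of the (one-based) positions `i < n` with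
`π_i > π_{i+1}`. -/
def majA (π : ColoredPerm r n) : ℕ :=
  ∑ i : Fin n, if h : (i : ℕ) + 1 < n then
    (if letterLT (π.letter ⟨(i : ℕ) + 1, h⟩) (π.letter i) then (i : ℕ) + 1 else 0) else 0

/-- The absolute value `|π_i| ∈ {1, …, n}`. -/
def absVal (π : ColoredPerm r n) (i : Fin n) : ℕ := (π.σ i : ℕ) + 1

/-- Bagno's statistic `lmaj π = maj_A π + ∑_{z_i > 0} (|π_i| + z_i - 1)`, where the colors are
represented by `0, …, r - 1`. -/
def lmaj (π : ColoredPerm r n) : ℕ :=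
  π.majA + ∑ i : Fin n, if π.z i ≠ 0 then π.absVal i + (π.z i).val - 1 else 0

/-- The sum of colors `∑ z_i`, the colors being represented by `0, …, r - 1`. -/
def colorSum (π : ColoredPerm r n) : ℕ := ∑ i : Fin n, (π.z i).val

/-- `χ_{a,b} π = (-1) ^ (a (ℓ(π) - ∑ z_i)) * ω ^ (b ∑ z_i)`. -/
noncomputable def chi (ω : ℂ) (a b : ℕ) (π : ColoredPerm r n) : ℂ :=
  (-1 : ℂ) ^ ((a : ℤ) * ((π.length : ℤ) - (π.colorSum : ℤ))) * ω ^ (b * π.colorSum)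

end ColoredPerm

/-- The `q`-analogue `[k]_x = 1 + x + ⋯ + x ^ (k - 1)`. -/
noncomputable def qAnalogue (k : ℕ) (x : Polynomial ℂ) : Polynomial ℂ :=
  ∑ i ∈ Finset.range k, x ^ i

/-! The proof rests on a length formula: ℓ(π) = inv(π) + ∑_{z_i > 0} (|π_i| - 1) + ∑ z_i, where inv
counts inversions in the given letter order (`length_eq`). The first two terms form `reducedLength`,
whose parity is the sign of σ (`sign_σ_eq`), so χ_{a,b}(π) = sign(σ)^a ω^{b ∑ z_i} is
multiplicative. Conversely, a character is fixed by its values on s₀, an r-th root of unity, and on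
the mutually conjugate s₁, …, sₙ₋₁, a common sign.

Since lmaj is the same expression with maj in place of inv, both identities are proved alike. Once
the color of each digit is fixed, the alphabet consists of n distinct letters, and σ runs over all
their arrangements. Summing over σ gives the distribution of inv, or of maj signed by inv; both
depend only on the relative order of the letters (`sum_perm_pow_inversionCount`,
`sum_perm_sign_mul_pow_majorIndex`). What remains depends only on the coloring and factors over the
digits (`sum_prod_digitWeight`). -/

/-! ### Inversions and major index of words -/

section Word

variable {α : Type*} [LinearOrder α]

/-- The number of inversions of a word, that is, of pairs `i < j` with `f j < f i`. -/
def inversionCount {n : ℕ} (f : Fin n → α) : ℕ :=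
  ∑ i : Fin n, ∑ j : Fin n, if i < j ∧ f j < f i then 1 else 0

/-- The major index of a word, the sum of its (one-based) descent positions. -/
def majorIndex {n : ℕ} (f : Fin n → α) : ℕ :=
  ∑ i : Fin n, if h : (i : ℕ) + 1 < n then
    (if f ⟨(i : ℕ) + 1, h⟩ < f i then (i : ℕ) + 1 else 0) else 0

theorem inversionCount_strictMono_comp {β : Type*} [LinearOrder β] {n : ℕ} {g : α → β}
    (hg : StrictMono g) (f : Fin n → α) :
    inversionCount (fun i => g (f i)) = inversionCount f := by
  simp only [inversionCount, hg.lt_iff_lt]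

theorem majorIndex_strictMono_comp {β : Type*} [LinearOrder β] {n : ℕ} {g : α → β}
    (hg : StrictMono g) (f : Fin n → α) :
    majorIndex (fun i => g (f i)) = majorIndex f := by
  simp only [majorIndex, hg.lt_iff_lt]

theorem inversionCount_of_monotone {n : ℕ} {f : Fin n → α} (hf : Monotone f) :
    inversionCount f = 0 := by
  refine Finset.sum_eq_zero fun i _ => Finset.sum_eq_zero fun j _ => ?_
  rw [if_neg]
  rintro ⟨h1, h2⟩
  exact absurd (hf h1.le) (not_le.2 h2)

theorem inversionCount_succ {n : ℕ} (f : Fin (n + 1) → α) :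
    inversionCount f = (∑ j : Fin n, if f j.succ < f 0 then 1 else 0) +
      inversionCount (fun i => f i.succ) := by
  simp only [inversionCount]
  rw [Fin.sum_univ_succ]
  simp only [Fin.sum_univ_succ (n := n), Fin.succ_pos, true_and, lt_self_iff_false, false_and,
    Fin.not_lt_zero, if_false, zero_add, Fin.succ_lt_succ_iff]

theorem majorIndex_succ {n : ℕ} (f : Fin (n + 1) → α) :
    majorIndex f = ∑ i : Fin n, if f i.succ < f i.castSucc then (i : ℕ) + 1 else 0 := by
  rw [majorIndex, Fin.sum_univ_castSucc]
  simp [Fin.succ]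

theorem inversionCount_eq_card {n : ℕ} (f : Fin n → α) :
    inversionCount f =
      (Finset.univ.filter fun p : Fin n × Fin n => p.1 < p.2 ∧ f p.2 < f p.1).card := by
  rw [inversionCount, Finset.card_filter, Fintype.sum_prod_type]

theorem inversionCount_swap_of_lt {n : ℕ} (f : Fin n → α) {i j : Fin n}
    (hij : (j : ℕ) = i + 1) (h : f i < f j) :
    inversionCount (fun k => f (Equiv.swap i j k)) = inversionCount f + 1 := by
  classical
  have hlt : i < j := by rw [Fin.lt_def]; omega
  -- Because `i` and `j` are adjacent, the swap changes the relative order of no pair of positions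
  -- except `{i, j}`.
  have key : (Finset.univ.filter fun p : Fin n × Fin n =>
      Equiv.swap i j p.1 < Equiv.swap i j p.2 ∧ f p.2 < f p.1) =
      insert (j, i) (Finset.univ.filter fun p : Fin n × Fin n => p.1 < p.2 ∧ f p.2 < f p.1) := by
    ext ⟨a, b⟩
    simp only [Finset.mem_filter, Finset.mem_univ, true_and, Finset.mem_insert, Prod.mk.injEq]
    by_cases hab : a = b
    · subst hab
      simp only [lt_self_iff_false, false_and, or_false, false_iff, not_and]
      rintro rfl rfl; exact lt_irrefl _ hlt
    by_cases h1 : a = j ∧ b = i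
    · obtain ⟨rfl, rfl⟩ := h1
      simp [hlt, h]
    by_cases h2 : a = i ∧ b = j
    · obtain ⟨rfl, rfl⟩ := h2
      simp [hlt.ne, hlt.not_gt, h.not_gt]
    have : Equiv.swap i j a < Equiv.swap i j b ↔ a < b := by
      simp only [Equiv.swap_apply_def]
      simp only [Fin.ext_iff, Fin.lt_def] at *
      split_ifs <;> omega
    rw [this]; tauto
  rw [inversionCount_eq_card, inversionCount_eq_card f, ← Finset.card_insert_of_notMem (a := (j, i)),
    ← key]
  · refine Finset.card_bij' (fun p _ => (Equiv.swap i j p.1, Equiv.swap i j p.2))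
      (fun p _ => (Equiv.swap i j p.1, Equiv.swap i j p.2)) ?_ ?_ ?_ ?_ <;> simp
  · simp [hlt.not_gt]

end Word

/-! ### Mahonian and signed Mahonian distributions on the symmetric group -/

section Mahonian

open Equiv

theorem Equiv.Perm.sign_eq_neg_one_pow_inversionCount {n : ℕ} (σ : Perm (Fin n)) :
    Perm.sign σ = (-1) ^ inversionCount σ := by
  rw [σ.sign_eq_prod_prod_Ioi, inversionCount, ← Finset.prod_pow_eq_pow_sum]
  refine Finset.prod_congr rfl fun i _ => ?_
  rw [← Finset.prod_pow_eq_pow_sum]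
  rw [← Finset.prod_subset (Finset.subset_univ (Finset.Ioi i))]
  · refine Finset.prod_congr rfl fun j hj => ?_
    have hij : i < j := by simpa using hj
    have : σ i ≠ σ j := fun h => hij.ne (σ.injective h)
    rcases this.lt_or_gt with h | h
    · simp [h, h.not_gt]
    · simp [h, hij, h.not_gt]
  · intro j _ hj
    have : ¬ i < j := by simpa using hj
    simp [this]

/-- The permutation with first letter `i` whose other letters form a word order-isomorphic
to `w`. -/
def Equiv.Perm.consPattern {n : ℕ} (i : Fin (n + 1)) (w : Perm (Fin n)) : Perm (Fin (n + 1)) :=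
  i.cycleRange.symm * Perm.decomposeFin.symm (0, w)

theorem Equiv.Perm.consPattern_zero {n : ℕ} (i : Fin (n + 1)) (w : Perm (Fin n)) :
    Perm.consPattern i w 0 = i := by
  simp [consPattern]

theorem Equiv.Perm.consPattern_succ {n : ℕ} (i : Fin (n + 1)) (w : Perm (Fin n)) (j : Fin n) :
    Perm.consPattern i w j.succ = i.succAbove (w j) := by
  simp [consPattern]

theorem Equiv.Perm.consPattern_bijective (n : ℕ) :
    Function.Bijective fun p : Fin (n + 1) × Perm (Fin n) => Perm.consPattern p.1 p.2 := by
  rw [Fintype.bijective_iff_injective_and_card]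
  refine ⟨?_, by simp [Fintype.card_perm, Nat.factorial_succ]⟩
  rintro ⟨i, w⟩ ⟨i', w'⟩ h
  have h0 : i = i' := by simpa [consPattern_zero] using DFunLike.congr_fun h 0
  subst h0
  refine Prod.ext rfl (Equiv.ext fun j => ?_)
  simpa [consPattern_succ] using DFunLike.congr_fun h j.succ

theorem Fin.sum_succAbove_lt {n : ℕ} (i : Fin (n + 1)) :
    (∑ j : Fin n, if i.succAbove j < i then 1 else 0) = (i : ℕ) := by
  have h := Fin.sum_univ_succAbove (fun k : Fin (n + 1) => if k < i then 1 else 0) i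
  simp only [lt_self_iff_false, if_false, zero_add] at h
  rw [← h, ← Finset.card_filter, Finset.filter_gt_eq_Iio, Fin.card_Iio]

theorem Equiv.Perm.inversionCount_consPattern {n : ℕ} (i : Fin (n + 1)) (w : Perm (Fin n)) :
    inversionCount (Perm.consPattern i w) = i + inversionCount w := by
  rw [inversionCount_succ]
  simp only [consPattern_zero, consPattern_succ]
  rw [inversionCount_strictMono_comp (Fin.strictMono_succAbove i),
    Equiv.sum_comp w fun k => if i.succAbove k < i then 1 else 0, Fin.sum_succAbove_lt]

theorem sum_perm_pow_inversionCount {R : Type*} [CommRing R] (x : R) (n : ℕ) :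
    ∑ σ : Perm (Fin n), x ^ inversionCount σ =
      ∏ k ∈ Finset.Icc 1 n, ∑ i ∈ Finset.range k, x ^ i := by
  induction n with
  | zero => simp [inversionCount]
  | succ n ih =>
    rw [← (Equiv.ofBijective _ (Perm.consPattern_bijective n)).sum_comp, Fintype.sum_prod_type,
      Finset.prod_Icc_succ_top (by omega), ← ih, mul_comm, ← Fin.sum_univ_eq_sum_range,
      Finset.sum_mul]
    refine Finset.sum_congr rfl fun i _ => ?_
    simp only [Equiv.ofBijective_apply, Perm.inversionCount_consPattern, pow_add, Finset.mul_sum]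

/-- The extension of a permutation of `Fin n` to `Fin (n + 1)` that fixes the last letter. -/
def Equiv.Perm.snocLast {n : ℕ} (w : Perm (Fin n)) : Perm (Fin (n + 1)) :=
  finSuccEquivLast.symm.permCongr (optionCongr w)

theorem Equiv.Perm.snocLast_last {n : ℕ} (w : Perm (Fin n)) :
    w.snocLast (Fin.last n) = Fin.last n := by
  simp [snocLast]

theorem Equiv.Perm.snocLast_castSucc {n : ℕ} (w : Perm (Fin n)) (i : Fin n) :
    w.snocLast i.castSucc = (w i).castSucc := by
  simp [snocLast]

theorem Equiv.Perm.sign_snocLast {n : ℕ} (w : Perm (Fin n)) :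
    Perm.sign w.snocLast = Perm.sign w := by
  rw [snocLast, sign_permCongr, optionCongr_sign]

theorem Equiv.Perm.majorIndex_snocLast {n : ℕ} (w : Perm (Fin n)) :
    majorIndex w.snocLast = majorIndex w := by
  rw [majorIndex_succ, majorIndex]
  refine Finset.sum_congr rfl fun i _ => ?_
  split_ifs with h1 h2 h3 h4 h5
  all_goals try rfl
  all_goals rw [snocLast_castSucc] at h1
  · have : i.succ = (⟨i + 1, h2⟩ : Fin n).castSucc := rfl
    rw [this, snocLast_castSucc, Fin.castSucc_lt_castSucc_iff] at h1
    contradiction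
  · have : i.succ = Fin.last n := Fin.ext (by simp; omega)
    rw [this, snocLast_last] at h1
    exact absurd h1 (Fin.castSucc_lt_last _).not_gt
  · have : i.succ = (⟨i + 1, h4⟩ : Fin n).castSucc := rfl
    rw [this, snocLast_castSucc, Fin.castSucc_lt_castSucc_iff] at h1
    contradiction

theorem finRotate_pow_last {n j : ℕ} (hj : j < n + 1) :
    (finRotate (n + 1) ^ (j + 1)) (Fin.last n) = ⟨j, hj⟩ := by
  induction j with
  | zero => simp
  | succ j ih =>
    rw [pow_succ', Perm.mul_apply, ih (by omega), finRotate_of_lt (by omega)]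

/-- Replacing every letter by its cyclic successor decreases the major index by one, except when
the largest letter comes last. -/
theorem majorIndex_finRotate_mul {n : ℕ} (σ : Perm (Fin (n + 1))) :
    majorIndex (finRotate (n + 1) * σ) + 1 =
      majorIndex σ + if σ (Fin.last n) = Fin.last n then n + 1 else 0 := by
  obtain ⟨p, hp⟩ := σ.surjective (Fin.last n)
  -- The maximum, at position `p`, becomes the minimum: a descent just after it is replaced by one
  -- just before it, and all other comparisons persist.
  have hterm : ∀ i : Fin n,
      (if (finRotate (n + 1) * σ) i.succ < (finRotate (n + 1) * σ) i.castSucc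
        then (i : ℕ) + 1 else 0) + (if i.castSucc = p then (i : ℕ) + 1 else 0) =
      (if σ i.succ < σ i.castSucc then (i : ℕ) + 1 else 0) +
        (if i.succ = p then (i : ℕ) + 1 else 0) := by
    intro i
    have e : ∀ k, σ k = Fin.last n ↔ k = p := fun k => by rw [← hp, σ.injective.eq_iff]
    have hne : i.castSucc ≠ i.succ := Fin.castSucc_lt_succ.ne
    have h1 := Fin.le_last (σ i.succ)
    have h2 := Fin.le_last (σ i.castSucc)
    simp only [Perm.mul_apply, Fin.lt_def, coe_finRotate, e]
    by_cases ha : i.castSucc = p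
    · have hb : i.succ ≠ p := fun h => hne (ha.trans h.symm)
      have h3 : σ i.succ < Fin.last n := lt_of_le_of_ne h1 (mt (e _).1 hb)
      rw [Fin.lt_def] at h3
      simpa [ha, hb, hp] using h3
    · by_cases hb : i.succ = p
      · simp only [if_neg ha, hb, if_true, hp]
        rw [Fin.le_def] at h2
        rw [if_pos (Nat.succ_pos _), if_neg (not_lt.2 h2)]; omega
      · simp [ha, hb]
  have hsum := Finset.sum_congr (rfl : (Finset.univ : Finset (Fin n)) = _) fun i _ => hterm i
  rw [Finset.sum_add_distrib, Finset.sum_add_distrib, ← majorIndex_succ, ← majorIndex_succ] at hsum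
  -- The correction terms of `hterm` sum to `p + 1` on the left (to 0 if `p` is last) and to `p` on
  -- the right.
  have e1 := Fin.sum_univ_castSucc fun k : Fin (n + 1) => if k = p then (k : ℕ) + 1 else 0
  have e2 := Fin.sum_univ_succ fun k : Fin (n + 1) => if k = p then (k : ℕ) else 0
  simp only [Finset.sum_ite_eq', Finset.mem_univ, if_true, Fin.val_castSucc, Fin.val_succ,
    Fin.val_last, Fin.val_zero, ite_self, zero_add] at e1 e2
  rw [← e2] at hsum
  have e3 : σ (Fin.last n) = Fin.last n ↔ Fin.last n = p := by rw [← hp, σ.injective.eq_iff, hp]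
  simp only [e3]
  split_ifs at e1 ⊢ with h
  · subst h; simp only [Fin.val_last] at *; omega
  · omega

theorem majorIndex_finRotate_pow_mul_snocLast {n : ℕ} (w : Perm (Fin n)) {j : ℕ}
    (hj : j < n + 1) :
    majorIndex (finRotate (n + 1) ^ (j + 1) * w.snocLast) = majorIndex w + (n - j) := by
  induction j with
  | zero =>
    have := majorIndex_finRotate_mul w.snocLast
    rw [if_pos w.snocLast_last, w.majorIndex_snocLast] at this
    simp only [zero_add, pow_one]; omega
  | succ j ih =>
    have := majorIndex_finRotate_mul (finRotate (n + 1) ^ (j + 1) * w.snocLast)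
    rw [ih (by omega), Perm.mul_apply, w.snocLast_last, finRotate_pow_last (by omega),
      if_neg (by simp [Fin.ext_iff]; omega), ← mul_assoc, ← pow_succ'] at this
    omega

/-- The last letter of the product is the index `p.1`; cancelling the rotation then recovers `p.2`.
-/
theorem finRotate_pow_mul_snocLast_bijective (n : ℕ) :
    Function.Bijective fun p : Fin (n + 1) × Perm (Fin n) =>
      finRotate (n + 1) ^ ((p.1 : ℕ) + 1) * p.2.snocLast := by
  rw [Fintype.bijective_iff_injective_and_card]
  refine ⟨?_, by simp [Fintype.card_perm, Nat.factorial_succ]⟩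
  rintro ⟨i, w⟩ ⟨i', w'⟩ h
  have h0 : i = i' := by
    have := DFunLike.congr_fun h (Fin.last n)
    simpa only [Perm.mul_apply, w.snocLast_last, w'.snocLast_last,
      finRotate_pow_last (Fin.is_lt _)] using this
  subst h0
  have h1 : w.snocLast = w'.snocLast := mul_left_cancel h
  refine Prod.ext rfl (Equiv.ext fun j => ?_)
  simpa [Perm.snocLast_castSucc] using DFunLike.congr_fun h1 j.castSucc

/-- The signed Mahonian identity of Gessel and Simion (`a = 1`) and MacMahon's theorem
(`a = 0`). -/
theorem sum_perm_sign_mul_pow_majorIndex {R : Type*} [CommRing R] (a : ℕ) (q : R) (n : ℕ) :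
    ∑ σ : Perm (Fin n), ((Perm.sign σ : ℤ) : R) ^ a * q ^ majorIndex σ =
      ∏ k ∈ Finset.Icc 1 n, ∑ i ∈ Finset.range k, ((-1) ^ (a * (k - 1)) * q) ^ i := by
  induction n with
  | zero => simp [majorIndex]
  | succ n ih =>
    rw [← (Equiv.ofBijective _ (finRotate_pow_mul_snocLast_bijective n)).sum_comp,
      Fintype.sum_prod_type, Finset.prod_Icc_succ_top (by omega), ← ih, mul_comm,
      ← Fin.sum_univ_eq_sum_range, ← Equiv.sum_comp Fin.revPerm, Finset.sum_mul]
    refine Finset.sum_congr rfl fun i _ => ?_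
    rw [Finset.mul_sum]
    refine Finset.sum_congr rfl fun w _ => ?_
    -- After the reversal, index `i` belongs to the rotation exponent `n - i + 1`, which adds `i` to
    -- the major index. One rotation has sign `(-1) ^ n`, and `n * (n + 1)` is even.
    have hpar : (-1 : R) ^ (n * (n - i + 1)) = (-1) ^ (n * i) := by
      have h := Nat.even_mul_succ_self n
      have h2 : n * (n + 1) = n * (n - i + 1) + n * i := by rw [← mul_add]; congr 1; omega
      rw [h2, Nat.even_add] at h
      exact neg_one_pow_congr h
    have hi : ((Fin.revPerm i : Fin (n + 1)) : ℕ) = n - i := by simp [Fin.val_rev]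
    rw [Equiv.ofBijective_apply, majorIndex_finRotate_pow_mul_snocLast _ (Fin.is_lt _), hi,
      Perm.sign_mul, map_pow, Perm.sign_snocLast, sign_finRotate, Nat.sub_sub_self (by omega)]
    push_cast
    rw [← pow_mul, hpar]
    ring

/-- Sorting the alphabet by `τ` makes the word of `τ * σ` order-isomorphic to `σ`, so statistics of
arrangements reduce to those of permutations. -/
theorem exists_perm_strictMono_comp {α : Type*} [LinearOrder α] {n : ℕ} {F : Fin n → α}
    (hF : Function.Injective F) : ∃ τ : Perm (Fin n), StrictMono fun i => F (τ i) :=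
  ⟨Tuple.sort F, (Tuple.monotone_sort F).strictMono_of_injective
    (hF.comp (Tuple.sort F).injective)⟩

theorem sum_perm_pow_inversionCount_comp {α R : Type*} [LinearOrder α] [CommRing R] {n : ℕ}
    {F : Fin n → α} (hF : Function.Injective F) (x : R) :
    ∑ σ : Perm (Fin n), x ^ inversionCount (fun i => F (σ i)) =
      ∏ k ∈ Finset.Icc 1 n, ∑ i ∈ Finset.range k, x ^ i := by
  obtain ⟨τ, hτ⟩ := exists_perm_strictMono_comp hF
  rw [← sum_perm_pow_inversionCount, ← Equiv.sum_comp (Equiv.mulLeft τ)]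
  refine Finset.sum_congr rfl fun σ _ => ?_
  rw [← inversionCount_strictMono_comp hτ σ]
  rfl

theorem sum_perm_pow_inversionCount_mul_pow_majorIndex_comp {α R : Type*} [LinearOrder α]
    [CommRing R] {n : ℕ} {F : Fin n → α} (hF : Function.Injective F) (a : ℕ) (q : R) :
    ∑ σ : Perm (Fin n), (-1) ^ (a * inversionCount fun i => F (σ i)) *
        q ^ majorIndex (fun i => F (σ i)) =
      ∏ k ∈ Finset.Icc 1 n, ∑ i ∈ Finset.range k, ((-1) ^ (a * (k - 1)) * q) ^ i := by
  obtain ⟨τ, hτ⟩ := exists_perm_strictMono_comp hF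
  rw [← sum_perm_sign_mul_pow_majorIndex, ← Equiv.sum_comp (Equiv.mulLeft τ)]
  refine Finset.sum_congr rfl fun σ _ => ?_
  rw [σ.sign_eq_neg_one_pow_inversionCount, ← inversionCount_strictMono_comp hτ σ,
    ← majorIndex_strictMono_comp hτ σ, mul_comm a, pow_mul]
  push_cast
  rfl

end Mahonian

/-! ### Colored letters as integer keys -/

namespace ColoredPerm

variable {r n : ℕ}

/-- An order embedding of the colored digits into the integers. -/
def letterKey (x : Fin n × ZMod r) : ℤ :=
  if x.2 = 0 then (x.1 : ℕ) else -(((x.1 : ℕ) * r + x.2.val + 1 : ℕ) : ℤ)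

theorem letterLT_iff [NeZero r] (x y : Fin n × ZMod r) :
    letterLT x y ↔ letterKey x < letterKey y := by
  obtain ⟨i, c⟩ := x
  obtain ⟨j, d⟩ := y
  have hc := ZMod.val_lt c
  have hd := ZMod.val_lt d
  simp only [letterLT, letterKey]
  by_cases h1 : c = 0 <;> by_cases h2 : d = 0
  · simp [h1, h2]
  · simp only [h1, h2, ne_eq, if_true, if_false, not_true_eq_false, false_and, and_false, or_false,
      false_iff]
    omega
  · simp only [h1, h2, ne_eq, if_true, if_false, not_false_eq_true, and_true, not_true_eq_false,
      false_and, and_false, or_false, false_or, true_iff]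
    omega
  · simp only [h1, h2, ne_eq, false_and, not_false_eq_true, true_and, false_or, if_false,
      neg_lt_neg_iff, Nat.cast_lt, and_false, Nat.add_lt_add_iff_right]
    rcases lt_trichotomy i j with h | h | h
    · have h' := Nat.mul_le_mul_right r (Nat.succ_le_of_lt (Fin.lt_def.1 h))
      rw [Nat.succ_mul] at h'
      simp only [h.not_gt, h.ne, false_and, or_false, false_iff]
      omega
    · subst h; simp
    · have h' := Nat.mul_le_mul_right r (Nat.succ_le_of_lt (Fin.lt_def.1 h))
      rw [Nat.succ_mul] at h'
      simp only [h, true_or, true_iff]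
      omega

theorem letterKey_injective_digit [NeZero r] (c : Fin n → ZMod r) :
    Function.Injective fun i => letterKey (i, c i) := by
  intro i j h
  have h1 := mt (letterLT_iff (i, c i) (j, c j)).1 h.not_lt
  have h2 := mt (letterLT_iff (j, c j) (i, c i)).1 h.not_gt
  simp only [letterLT] at h1 h2
  by_contra hij
  rcases lt_or_gt_of_ne hij with h | h <;> tauto

/-- The word of keys of the letters of `π`. -/
def keys (π : ColoredPerm r n) (i : Fin n) : ℤ := letterKey (π.letter i)

theorem keys_eq (π : ColoredPerm r n) (i : Fin n) :
    π.keys i = letterKey (π.σ i, π.z (π.σ.symm (π.σ i))) := by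
  rw [keys, letter, Equiv.symm_apply_apply]

theorem keys_injective [NeZero r] (π : ColoredPerm r n) : Function.Injective π.keys := by
  intro i j h
  rw [keys_eq, keys_eq] at h
  exact π.σ.injective (letterKey_injective_digit (fun d => π.z (π.σ.symm d)) h)

theorem majA_eq_majorIndex [NeZero r] (π : ColoredPerm r n) : π.majA = majorIndex π.keys := by
  simp only [majA, majorIndex, letterLT_iff]
  rfl

/-! ### The length formula -/

/-- The length of `π` diminished by the sum of its colors; see `length_eq`. -/
def reducedLength (π : ColoredPerm r n) : ℕ :=
  inversionCount π.keys + ∑ i, if π.z i ≠ 0 then (π.σ i : ℕ) else 0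

theorem lmaj_eq [NeZero r] (π : ColoredPerm r n) :
    π.lmaj = majorIndex π.keys +
      ((∑ i, if π.z i ≠ 0 then (π.σ i : ℕ) else 0) + π.colorSum) := by
  rw [lmaj, majA_eq_majorIndex, colorSum, ← Finset.sum_add_distrib]
  congr 1
  refine Finset.sum_congr rfl fun i _ => ?_
  split_ifs with h
  · rw [absVal]; omega
  · simp [not_not.1 h]

/-- The right side does not involve the color of the first letter; hence s₀ leaves `reducedLength`
unchanged. Coloring that letter loses its inversions with smaller uncolored digits and with smaller
colored ones, but the added `π.σ 0` counts exactly the smaller digits. -/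
theorem reducedLength_succ [NeZero r] (π : ColoredPerm r (n + 1)) :
    π.reducedLength =
      (∑ j : Fin n, if π.z j.succ ≠ 0 ∨ π.σ j.succ < π.σ 0 then 1 else 0) +
        (inversionCount (fun j : Fin n => π.keys j.succ) +
          ∑ j : Fin n, if π.z j.succ ≠ 0 then (π.σ j.succ : ℕ) else 0) := by
  have hne : ∀ j : Fin n, π.σ j.succ ≠ π.σ 0 := fun j => π.σ.injective.ne (Fin.succ_ne_zero j)
  have hσ : (π.σ 0 : ℕ) = ∑ j : Fin n, if π.σ j.succ < π.σ 0 then 1 else 0 := by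
    have h1 := Equiv.sum_comp π.σ fun k => if k < π.σ 0 then 1 else 0
    rw [Fin.sum_univ_succ, if_neg (lt_irrefl _), zero_add] at h1
    rw [h1, ← Finset.card_filter, Finset.filter_gt_eq_Iio, Fin.card_Iio]
  have head : (∑ j : Fin n, if π.keys j.succ < π.keys 0 then 1 else 0) +
      (if π.z 0 ≠ 0 then (π.σ 0 : ℕ) else 0) =
      ∑ j : Fin n, if π.z j.succ ≠ 0 ∨ π.σ j.succ < π.σ 0 then 1 else 0 := by
    simp only [keys, ← letterLT_iff, letterLT, letter]
    by_cases h : π.z 0 = 0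
    · simp only [h, ne_eq, not_true_eq_false, if_false, add_zero, false_and, and_false, or_false,
        and_true, true_and]
      refine Finset.sum_congr rfl fun j _ => if_congr ?_ rfl rfl
      tauto
    · rw [if_pos h, hσ, ← Finset.sum_add_distrib]
      refine Finset.sum_congr rfl fun j _ => ?_
      have := hne j
      simp only [h, ne_eq, not_false_eq_true, false_and, and_false, false_or, true_and, this,
        or_false]
      rcases this.lt_or_gt with h' | h'
      · simp [h', h'.not_gt]
      · simp [h', h'.not_gt]
  rw [reducedLength, inversionCount_succ, Fin.sum_univ_succ, ← head]
  ring

theorem reducedLength_congr [NeZero r] {π τ : ColoredPerm r n} (hσ : π.σ = τ.σ)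
    (hz : ∀ j : Fin n, (j : ℕ) ≠ 0 → π.z j = τ.z j) : π.reducedLength = τ.reducedLength := by
  cases n with
  | zero => simp [reducedLength, inversionCount]
  | succ n =>
    have hz' : ∀ j : Fin n, π.z j.succ = τ.z j.succ := fun j => hz _ (by simp)
    simp only [reducedLength_succ, hσ, hz', keys, letter]

theorem reducedLength_one : (1 : ColoredPerm r n).reducedLength = 0 := by
  rw [reducedLength, inversionCount_of_monotone]
  · simp [one_z]
  · intro i j h
    simpa [keys, letter, letterKey, one_z, one_σ] using h

theorem colorSum_one : (1 : ColoredPerm r n).colorSum = 0 := by simp [colorSum, one_z]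

theorem mul_gen_zero_z (π : ColoredPerm r n) {i : Fin n} (hi : (i : ℕ) = 0) (j : Fin n) :
    (π * gen i).z j = if (j : ℕ) = 0 then 1 + π.z j else π.z j := by
  rw [mul_z, gen, if_pos hi]
  dsimp only [Equiv.Perm.one_apply]
  split_ifs <;> simp

theorem mul_gen_zero_σ (π : ColoredPerm r n) {i : Fin n} (hi : (i : ℕ) = 0) :
    (π * gen i).σ = π.σ := by
  rw [mul_σ, gen, if_pos hi, mul_one]

theorem reducedLength_mul_gen_zero [NeZero r] (π : ColoredPerm r n) {i : Fin n}
    (hi : (i : ℕ) = 0) : (π * gen i).reducedLength = π.reducedLength :=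
  reducedLength_congr (mul_gen_zero_σ π hi) fun j hj => by rw [mul_gen_zero_z π hi, if_neg hj]

theorem colorSum_mul_gen_zero_le [NeZero r] (π : ColoredPerm r n) {i : Fin n}
    (hi : (i : ℕ) = 0) : (π * gen i).colorSum ≤ π.colorSum + 1 := by
  have h : π.colorSum + 1 = ∑ j, ((π.z j).val + if i = j then 1 else 0) := by
    simp [colorSum, Finset.sum_add_distrib]
  rw [h, colorSum]
  refine Finset.sum_le_sum fun j _ => ?_
  rw [mul_gen_zero_z π hi]
  have hij : i = j ↔ (j : ℕ) = 0 := by rw [Fin.ext_iff, hi, eq_comm]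
  simp only [hij]
  split_ifs
  · refine (ZMod.val_add_le _ _).trans ?_
    rw [ZMod.val_one_eq_one_mod, add_comm]
    exact Nat.add_le_add_left (Nat.mod_le _ _) _
  · simp

theorem mul_gen_keys (π : ColoredPerm r n) {i j : Fin n} (hij : (j : ℕ) = i + 1) (k : Fin n) :
    (π * gen j).keys k = π.keys (Equiv.swap i j k) := by
  have : (⟨(j : ℕ) - 1, lt_of_le_of_lt (Nat.sub_le _ _) j.isLt⟩ : Fin n) = i :=
    Fin.ext (by simp [hij])
  rw [keys, letter, mul_z, mul_σ, gen, if_neg (by omega), this]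
  simp [keys, letter]

theorem gen_of_eq_succ {i j : Fin n} (hij : (j : ℕ) = i + 1) :
    (gen j : ColoredPerm r n) = ⟨fun _ => 0, Equiv.swap i j⟩ := by
  have : (⟨(j : ℕ) - 1, lt_of_le_of_lt (Nat.sub_le _ _) j.isLt⟩ : Fin n) = i :=
    Fin.ext (by simp [hij])
  rw [gen, if_neg (by omega), this]

theorem mul_gen_mul_gen (π : ColoredPerm r n) {i j : Fin n} (hij : (j : ℕ) = i + 1) :
    π * gen j * gen j = π := by
  rw [gen_of_eq_succ hij]
  refine ColoredPerm.ext ?_ ?_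
  · funext k; simp [mul_z]
  · simp [mul_σ, mul_assoc]

theorem colorSum_mul_gen (π : ColoredPerm r n) {i j : Fin n} (hij : (j : ℕ) = i + 1) :
    (π * gen j).colorSum = π.colorSum := by
  rw [gen_of_eq_succ hij, colorSum, colorSum, ← Equiv.sum_comp (Equiv.swap i j)]
  simp [mul_z]

/-- Right multiplication by an adjacent transposition moves the letters with their colors, so only
the inversion count changes. -/
theorem reducedLength_mul_gen_of_lt (π : ColoredPerm r n) {i j : Fin n} (hij : (j : ℕ) = i + 1)
    (h : π.keys i < π.keys j) : (π * gen j).reducedLength = π.reducedLength + 1 := by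
  have h1 : inversionCount (π * gen j).keys = inversionCount π.keys + 1 := by
    rw [← inversionCount_swap_of_lt _ hij h]
    exact congrArg inversionCount (funext fun k => mul_gen_keys π hij k)
  have h2 : (∑ k, if (π * gen j).z k ≠ 0 then ((π * gen j).σ k : ℕ) else 0) =
      ∑ k, if π.z k ≠ 0 then (π.σ k : ℕ) else 0 := by
    rw [← Equiv.sum_comp (Equiv.swap i j) (fun k => if π.z k ≠ 0 then (π.σ k : ℕ) else 0),
      gen_of_eq_succ hij]
    simp [mul_z, mul_σ]
  rw [reducedLength, reducedLength, h2, h1]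
  ring

theorem reducedLength_mul_gen_of_gt (π : ColoredPerm r n) {i j : Fin n} (hij : (j : ℕ) = i + 1)
    (h : π.keys j < π.keys i) : π.reducedLength = (π * gen j).reducedLength + 1 := by
  have h' : (π * gen j).keys i < (π * gen j).keys j := by
    rw [mul_gen_keys π hij, mul_gen_keys π hij]
    simpa using h
  rw [← reducedLength_mul_gen_of_lt (π * gen j) hij h', mul_gen_mul_gen π hij]

theorem exists_pred_of_ne_zero {j : Fin n} (hj : (j : ℕ) ≠ 0) : ∃ i : Fin n, (j : ℕ) = i + 1 :=
  ⟨⟨j - 1, by omega⟩, by simp; omega⟩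

theorem reducedLength_add_colorSum_mul_gen_le [NeZero r] (π : ColoredPerm r n) (j : Fin n) :
    (π * gen j).reducedLength + (π * gen j).colorSum ≤
      π.reducedLength + π.colorSum + 1 := by
  by_cases hj : (j : ℕ) = 0
  · rw [reducedLength_mul_gen_zero π hj, add_assoc]
    exact Nat.add_le_add_left (colorSum_mul_gen_zero_le π hj) _
  · obtain ⟨i, hij⟩ := exists_pred_of_ne_zero hj
    rw [colorSum_mul_gen π hij]
    have hne : i ≠ j := fun h => by rw [h] at hij; omega
    rcases (π.keys_injective.ne hne).lt_or_gt with h | h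
    · have := reducedLength_mul_gen_of_lt π hij h; omega
    · have := reducedLength_mul_gen_of_gt π hij h; omega

theorem reducedLength_add_colorSum_prod_le [NeZero r] (w : List (Fin n)) :
    (w.map (gen : Fin n → ColoredPerm r n)).prod.reducedLength +
      (w.map (gen : Fin n → ColoredPerm r n)).prod.colorSum ≤ w.length := by
  induction w using List.reverseRecOn with
  | nil => simp [reducedLength_one, colorSum_one]
  | append_singleton w j ih =>
    have := reducedLength_add_colorSum_mul_gen_le (w.map (gen : Fin n → ColoredPerm r n)).prod j
    simp only [List.map_append, List.map_cons, List.map_nil, List.prod_append, List.prod_cons,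
      List.prod_nil, mul_one, List.length_append, List.length_cons, List.length_nil]
    omega

theorem eq_one_of_keys_strictMono [NeZero r] {π : ColoredPerm r n} (hmono : StrictMono π.keys)
    (hz : ∀ i : Fin n, (i : ℕ) = 0 → π.z i = 0) : π = 1 := by
  have hz' : ∀ i, π.z i = 0 := by
    intro i
    -- Colored letters have negative keys, so an increasing word that starts uncolored has no colors
    -- at all.
    have h0 : 0 ≤ π.keys ⟨0, i.pos⟩ := by
      rw [keys, letter, letterKey, if_pos (hz _ rfl)]; positivity
    have h1 : π.keys ⟨0, i.pos⟩ ≤ π.keys i := hmono.monotone (Fin.le_def.2 (Nat.zero_le _))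
    by_contra h
    rw [keys, keys, letter, letter, letterKey, letterKey, if_neg h] at *
    omega
  have hσ : StrictMono π.σ := by
    intro i j h
    simpa [keys, letter, letterKey, hz'] using hmono h
  refine ColoredPerm.ext (funext hz') (Equiv.ext fun i => ?_)
  exact congrArg (fun e : Fin n ≃o Fin n => e i)
    (Subsingleton.elim (hσ.orderIsoOfSurjective _ π.σ.surjective) (OrderIso.refl _))

theorem exists_word [NeZero r] (π : ColoredPerm r n) :
    ∃ w : List (Fin n), w.length = π.reducedLength + π.colorSum ∧ (w.map gen).prod = π := by
  induction h : π.reducedLength + π.colorSum using Nat.strong_induction_on generalizing π with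
  | _ m ih =>
  subst h
  -- A last factor is split off: a swap at a descent if the first letter is uncolored, otherwise s₀.
  suffices h : π = 1 ∨ ∃ (τ : ColoredPerm r n) (j : Fin n), τ * gen j = π ∧
      π.reducedLength + π.colorSum = τ.reducedLength + τ.colorSum + 1 by
    rcases h with rfl | ⟨τ, j, rfl, h⟩
    · exact ⟨[], by simp [reducedLength_one, colorSum_one], rfl⟩
    · obtain ⟨w, hw1, hw2⟩ := ih _ (by omega) τ rfl
      exact ⟨w ++ [j], by simp [hw1, h], by simp [hw2]⟩
  by_cases hz : ∀ i : Fin n, (i : ℕ) = 0 → π.z i = 0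
  · by_cases hd : ∃ i j : Fin n, (j : ℕ) = i + 1 ∧ π.keys j < π.keys i
    · obtain ⟨i, j, hij, h⟩ := hd
      refine Or.inr ⟨π * gen j, j, mul_gen_mul_gen π hij, ?_⟩
      rw [colorSum_mul_gen π hij, reducedLength_mul_gen_of_gt π hij h]
      ring
    · push Not at hd
      refine Or.inl (eq_one_of_keys_strictMono (Monotone.strictMono_of_injective ?_
        π.keys_injective) hz)
      cases n with
      | zero => intro i; exact i.elim0
      | succ n => exact Fin.monotone_iff_le_succ.2 fun i => hd _ _ (by simp)
  · push Not at hz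
    obtain ⟨i, hi, hz⟩ := hz
    right
    -- A nonzero color can be lowered by one without wrapping around modulo `r`.
    have hval : (π.z i).val = (π.z i - 1).val + 1 := by
      have h0 : 0 < (π.z i).val := Nat.pos_of_ne_zero (mt (ZMod.val_eq_zero _).1 hz)
      have hlt := ZMod.val_lt (π.z i)
      have : π.z i - 1 = (((π.z i).val - 1 : ℕ) : ZMod r) := by
        rw [Nat.cast_sub h0, ZMod.natCast_zmod_val, Nat.cast_one]
      rw [this, ZMod.val_natCast_of_lt (by omega)]
      omega
    let τ : ColoredPerm r n := ⟨Function.update π.z i (π.z i - 1), π.σ⟩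
    have hji : ∀ j : Fin n, (j : ℕ) = 0 ↔ j = i := fun j => by rw [Fin.ext_iff, hi]
    have hτ : τ * gen i = π := by
      refine ColoredPerm.ext (funext fun j => ?_) (mul_gen_zero_σ τ hi)
      rw [mul_gen_zero_z τ hi]
      simp only [hji, τ]
      split_ifs with h
      · subst h; simp
      · simp [h]
    refine ⟨τ, i, hτ, ?_⟩
    have h1 : π.reducedLength = τ.reducedLength := by
      rw [← reducedLength_mul_gen_zero τ hi, hτ]
    have h2 : π.colorSum = τ.colorSum + 1 := by
      have : ∀ j, (π.z j).val = (τ.z j).val + if i = j then 1 else 0 := by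
        intro j
        by_cases h : j = i
        · subst h; simp [τ, hval]
        · simp [τ, h, Ne.symm h]
      simp [colorSum, this, Finset.sum_add_distrib]
    omega

theorem length_eq [NeZero r] (π : ColoredPerm r n) :
    π.length = π.reducedLength + π.colorSum := by
  apply le_antisymm
  · exact Nat.sInf_le π.exists_word
  · refine le_csInf ⟨_, π.exists_word⟩ ?_
    rintro k ⟨w, rfl, rfl⟩
    exact reducedLength_add_colorSum_prod_le w

/-- Along a word, s₀ affects neither side and each adjacent transposition flips both. -/
theorem sign_σ_eq [NeZero r] (π : ColoredPerm r n) :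
    Equiv.Perm.sign π.σ = (-1) ^ π.reducedLength := by
  obtain ⟨w, -, rfl⟩ := π.exists_word
  induction w using List.reverseRecOn with
  | nil => simp [reducedLength_one, one_σ]
  | append_singleton w j ih =>
    simp only [List.map_append, List.map_cons, List.map_nil, List.prod_append, List.prod_cons,
      List.prod_nil, mul_one]
    by_cases hj : (j : ℕ) = 0
    · rw [reducedLength_mul_gen_zero _ hj, mul_gen_zero_σ _ hj, ih]
    · obtain ⟨i, hij⟩ := exists_pred_of_ne_zero hj
      have hne : i ≠ j := fun h => by rw [h] at hij; omega
      have hs : Equiv.Perm.sign ((w.map (gen : Fin n → ColoredPerm r n)).prod * gen j).σ =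
          -(-1) ^ (w.map (gen : Fin n → ColoredPerm r n)).prod.reducedLength := by
        rw [mul_σ, Equiv.Perm.sign_mul, ih, gen_of_eq_succ hij, Equiv.Perm.sign_swap hne]
        simp
      rw [hs]
      rcases ((keys_injective (w.map (gen : Fin n → ColoredPerm r n)).prod).ne hne).lt_or_gt with
        h | h
      · rw [reducedLength_mul_gen_of_lt _ hij h, pow_succ]; simp
      · rw [reducedLength_mul_gen_of_gt _ hij h, pow_succ]; simp

end ColoredPerm

/-! ### One-dimensional characters -/

namespace ColoredPerm

variable {r n : ℕ}

theorem neg_one_pow_reducedLength [NeZero r] {R : Type*} [CommRing R] (π : ColoredPerm r n) :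
    (-1 : R) ^ π.reducedLength = ((Equiv.Perm.sign π.σ : ℤ) : R) := by
  rw [sign_σ_eq]; push_cast; rfl

theorem chi_eq [NeZero r] (ω : ℂ) (a b : ℕ) (π : ColoredPerm r n) :
    chi ω a b π = (-1) ^ (a * π.reducedLength) * ω ^ (b * π.colorSum) := by
  have : (a : ℤ) * ((π.length : ℤ) - (π.colorSum : ℤ)) = ((a * π.reducedLength : ℕ) : ℤ) := by
    rw [length_eq]; push_cast; ring
  rw [chi, this, zpow_natCast]

theorem pow_val_add [NeZero r] {ω : ℂ} (hω : ω ^ r = 1) (x y : ZMod r) :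
    ω ^ (x + y).val = ω ^ x.val * ω ^ y.val := by
  rw [ZMod.val_add, ← pow_add, ← pow_eq_pow_mod _ hω]

theorem pow_colorSum (ω : ℂ) (π : ColoredPerm r n) :
    ω ^ π.colorSum = ∏ i, ω ^ (π.z i).val := by
  rw [colorSum, Finset.prod_pow_eq_pow_sum]

theorem pow_colorSum_mul [NeZero r] {ω : ℂ} (hω : ω ^ r = 1) (π τ : ColoredPerm r n) :
    ω ^ (π * τ).colorSum = ω ^ π.colorSum * ω ^ τ.colorSum := by
  simp only [pow_colorSum, mul_z, pow_val_add hω, Finset.prod_mul_distrib]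
  rw [Equiv.prod_comp τ.σ fun i => ω ^ (π.z i).val, mul_comm]

/-- `chi ω a b` as a monoid homomorphism. -/
noncomputable def chiHom [NeZero r] {ω : ℂ} (hω : ω ^ r = 1) (a b : ℕ) :
    ColoredPerm r n →* ℂ where
  toFun := chi ω a b
  map_one' := by simp [chi_eq, reducedLength_one, colorSum_one]
  map_mul' π τ := by
    simp only [chi_eq, mul_comm a, mul_comm b, pow_mul, neg_one_pow_reducedLength,
      pow_colorSum_mul hω, mul_σ, Equiv.Perm.sign_mul]
    push_cast
    ring

theorem chiHom_apply [NeZero r] {ω : ℂ} (hω : ω ^ r = 1) (a b : ℕ) (π : ColoredPerm r n) :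
    chiHom hω a b π = chi ω a b π := rfl

theorem hom_ext_gen [NeZero r] {M : Type*} [Monoid M] {f g : ColoredPerm r n →* M}
    (h : ∀ i, f (gen i) = g (gen i)) : f = g := by
  ext π
  obtain ⟨w, -, rfl⟩ := π.exists_word
  rw [map_list_prod, map_list_prod, List.map_map, List.map_map]
  congr 2
  exact funext h

theorem chi_gen_zero [NeZero r] {ω : ℂ} (hω : ω ^ r = 1) (a b : ℕ) {i : Fin n}
    (hi : (i : ℕ) = 0) : chi ω a b (gen i : ColoredPerm r n) = ω ^ b := by
  -- The color sum is `1 % r` rather than 1 because s₀ is trivial when `r = 1`.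
  have h1 : (gen i : ColoredPerm r n).reducedLength = 0 := by
    rw [← one_mul (gen i), reducedLength_mul_gen_zero _ hi, reducedLength_one]
  have h2 : (gen i : ColoredPerm r n).colorSum = 1 % r := by
    rw [colorSum, gen, if_pos hi, Finset.sum_eq_single i]
    · simpa [hi] using ZMod.val_one_eq_one_mod r
    · intro j _ hj
      have : (j : ℕ) ≠ 0 := fun h => hj (Fin.ext (h.trans hi.symm))
      simp [this]
    · simp
  rw [chi_eq, h1, h2, mul_zero, pow_zero, one_mul, mul_comm, pow_mul, ← pow_eq_pow_mod _ hω,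
    pow_one]

theorem chi_gen_of_ne_zero [NeZero r] (ω : ℂ) (a b : ℕ) {j : Fin n} (hj : (j : ℕ) ≠ 0) :
    chi ω a b (gen j : ColoredPerm r n) = (-1) ^ a := by
  obtain ⟨i, hij⟩ := exists_pred_of_ne_zero hj
  have hne : i ≠ j := fun h => by rw [h] at hij; omega
  have h2 : (gen j : ColoredPerm r n).colorSum = 0 := by
    rw [← one_mul (gen j), colorSum_mul_gen _ hij, colorSum_one]
  rw [chi_eq, h2, mul_comm a, pow_mul, neg_one_pow_reducedLength, gen_of_eq_succ hij,
    Equiv.Perm.sign_swap hne]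
  simp

theorem gen_zero_pow (i : Fin n) (hi : (i : ℕ) = 0) (k : ℕ) :
    (gen i : ColoredPerm r n) ^ k = ⟨fun j => if (j : ℕ) = 0 then (k : ZMod r) else 0, 1⟩ := by
  induction k with
  | zero => refine ColoredPerm.ext (funext fun j => ?_) rfl; simp [one_z]
  | succ k ih =>
    refine ColoredPerm.ext (funext fun j => ?_) ?_
    · rw [pow_succ, mul_gen_zero_z _ hi, ih]
      split_ifs <;> simp [add_comm, *]
    · rw [pow_succ, mul_gen_zero_σ _ hi, ih]

/-- The symmetric group as the subgroup of uncolored permutations. -/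
def uncolored : Equiv.Perm (Fin n) →* ColoredPerm r n where
  toFun σ := ⟨fun _ => 0, σ⟩
  map_one' := rfl
  map_mul' σ τ := ColoredPerm.ext (funext fun i => by simp [mul_z]) rfl

theorem uncolored_swap {i j : Fin n} (hij : (j : ℕ) = i + 1) :
    uncolored (Equiv.swap i j) = (gen j : ColoredPerm r n) := (gen_of_eq_succ hij).symm

/-- A homomorphism from the symmetric group to a field takes the same value `1` or `-1` on all
transpositions. -/
theorem _root_.Equiv.Perm.exists_hom_swap_eq_neg_one_pow {α K : Type*} [DecidableEq α] [Field K]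
    (f : Equiv.Perm α →* K) : ∃ a < 2, ∀ x y : α, x ≠ y → f (Equiv.swap x y) = (-1) ^ a := by
  by_cases h : ∀ x y : α, x ≠ y → f (Equiv.swap x y) = 1
  · exact ⟨0, by norm_num, by simpa using h⟩
  · push Not at h
    obtain ⟨u, v, huv, h⟩ := h
    refine ⟨1, by norm_num, fun x y hxy => ?_⟩
    have hsq : f (Equiv.swap u v) * f (Equiv.swap u v) = 1 := by
      rw [← map_mul, Equiv.swap_mul_self, map_one]
    -- All transpositions are conjugate, and conjugate elements of a field are equal.
    rw [isConj_iff_eq.1 (f.map_isConj (Equiv.Perm.isConj_swap hxy huv)), pow_one]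
    exact (mul_self_eq_one_iff.1 hsq).resolve_left h

theorem exists_hom_eq_chi [NeZero r] (hn : 0 < n) {ω : ℂ} (hω : IsPrimitiveRoot ω r)
    (f : ColoredPerm r n →* ℂ) : ∃ a < 2, ∃ b < r, ∀ π, f π = chi ω a b π := by
  obtain ⟨a, ha, hswap⟩ := Equiv.Perm.exists_hom_swap_eq_neg_one_pow (f.comp uncolored)
  have h0 : f (gen ⟨0, hn⟩) ^ r = 1 := by
    rw [← map_pow, gen_zero_pow _ rfl, ← map_one f]
    congr 1
    refine ColoredPerm.ext (funext fun j => ?_) rfl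
    simp [one_z]
  obtain ⟨b, hb, hfb⟩ := hω.eq_pow_of_pow_eq_one h0
  refine ⟨a, ha, b, hb, fun π => ?_⟩
  rw [← chiHom_apply hω.pow_eq_one]
  refine DFunLike.congr_fun (hom_ext_gen fun j => ?_) π
  rw [chiHom_apply]
  by_cases hj : (j : ℕ) = 0
  · rw [chi_gen_zero hω.pow_eq_one _ _ hj, hfb]
    congr 2
    exact Fin.ext hj
  · obtain ⟨i, hij⟩ := exists_pred_of_ne_zero hj
    have hne : i ≠ j := fun h => by rw [h] at hij; omega
    rw [chi_gen_of_ne_zero _ _ _ hj, ← uncolored_swap hij]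
    exact hswap i j hne

/-! ### Generating functions: summation over colorings and arrangements -/

/-- Colored permutations as pairs of a coloring of the digits and a permutation. -/
def digitColoring : (Fin n → ZMod r) × Equiv.Perm (Fin n) ≃ ColoredPerm r n where
  toFun p := ⟨fun i => p.1 (p.2 i), p.2⟩
  invFun π := (fun d => π.z (π.σ.symm d), π.σ)
  left_inv p := by simp
  right_inv π := by simp

theorem colorSum_digitColoring (c : Fin n → ZMod r) (σ : Equiv.Perm (Fin n)) :
    (digitColoring (c, σ)).colorSum = ∑ d, (c d).val :=
  Equiv.sum_comp σ fun d => (c d).val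

theorem keys_digitColoring (c : Fin n → ZMod r) (σ : Equiv.Perm (Fin n)) :
    (digitColoring (c, σ)).keys = fun i => letterKey (σ i, c (σ i)) := rfl

theorem sum_colored_digitColoring (c : Fin n → ZMod r) (σ : Equiv.Perm (Fin n)) :
    (∑ i, if (digitColoring (c, σ)).z i ≠ 0 then ((digitColoring (c, σ)).σ i : ℕ) else 0) =
      ∑ d, if c d ≠ 0 then (d : ℕ) else 0 :=
  Equiv.sum_comp σ fun d => if c d ≠ 0 then (d : ℕ) else 0

open Polynomial

/-- The contribution of the digit `d` (counted from zero) with color `c`. -/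
noncomputable def digitWeight (ω : ℂ) (a b d : ℕ) (c : ZMod r) : ℂ[X] :=
  ((-1) ^ a * X) ^ (if c ≠ 0 then d else 0) * (C (ω ^ b) * X) ^ c.val

theorem sum_zmod_val [NeZero r] {M : Type*} [AddCommMonoid M] (g : ℕ → M) :
    ∑ c : ZMod r, g c.val = ∑ v ∈ Finset.range r, g v := by
  cases r with
  | zero => exact absurd rfl (NeZero.ne 0)
  | succ m => exact Fin.sum_univ_eq_sum_range g (m + 1)

theorem sum_digitWeight [NeZero r] (ω : ℂ) (a b d : ℕ) :
    ∑ c : ZMod r, digitWeight ω a b d c =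
      1 + (-1) ^ (a * (d + 1 + 1)) * C (ω ^ b) * X ^ (d + 1) *
        qAnalogue (r - 1) (C (ω ^ b) * X) := by
  have h : (-1 : ℂ[X]) ^ (a * (d + 1 + 1)) = (-1) ^ (a * d) := by
    apply neg_one_pow_congr
    rw [add_assoc, mul_add, Nat.even_add]
    simp
  have hw : ∑ c : ZMod r, digitWeight ω a b d c = ∑ v ∈ Finset.range r,
      ((-1) ^ a * X) ^ (if v ≠ 0 then d else 0) * (C (ω ^ b) * X) ^ v := by
    rw [← sum_zmod_val fun v : ℕ =>
      ((-1 : ℂ[X]) ^ a * X) ^ (if v ≠ 0 then d else 0) * (C (ω ^ b) * X) ^ v]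
    simp only [digitWeight, ne_eq, ZMod.val_eq_zero]
  obtain ⟨m, hm⟩ := Nat.exists_eq_succ_of_ne_zero (NeZero.ne r)
  have hr : r - 1 = m := by omega
  -- The term `v = 0` gives the 1; the others share the factor `C (ω ^ b) * X`, which raises `X ^ d`
  -- to `X ^ (d + 1)`.
  rw [hw, h, qAnalogue, hr, hm, Nat.succ_eq_add_one, Finset.sum_range_succ', Finset.mul_sum,
    add_comm]
  refine congrArg₂ (· + ·) (by simp) (Finset.sum_congr rfl fun v _ => ?_)
  rw [if_pos v.succ_ne_zero, mul_pow, ← pow_mul]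
  ring

theorem prod_Icc_one_eq_prod_fin {M : Type*} [CommMonoid M] (f : ℕ → M) (n : ℕ) :
    ∏ k ∈ Finset.Icc 1 n, f k = ∏ d : Fin n, f (d + 1) := by
  induction n with
  | zero => simp
  | succ n ih => rw [Finset.prod_Icc_succ_top (by omega), ih, Fin.prod_univ_castSucc]; rfl

theorem sum_prod_digitWeight [NeZero r] (ω : ℂ) (a b n : ℕ) :
    ∑ c : Fin n → ZMod r, ∏ d : Fin n, digitWeight ω a b d (c d) =
      ∏ k ∈ Finset.Icc 1 n, (1 + (-1) ^ (a * (k + 1)) * C (ω ^ b) * X ^ k *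
        qAnalogue (r - 1) (C (ω ^ b) * X)) := by
  rw [prod_Icc_one_eq_prod_fin]
  simp only [← sum_digitWeight]
  rw [Finset.prod_univ_sum, Fintype.piFinset_univ]

theorem prod_digitWeight (ω : ℂ) (a b : ℕ) (c : Fin n → ZMod r) :
    ∏ d : Fin n, digitWeight ω a b d (c d) =
      ((-1) ^ a * X) ^ (∑ d, if c d ≠ 0 then (d : ℕ) else 0) *
        (C (ω ^ b) * X) ^ ∑ d, (c d).val := by
  simp only [digitWeight, Finset.prod_mul_distrib, Finset.prod_pow_eq_pow_sum]

theorem C_chi [NeZero r] (ω : ℂ) (a b : ℕ) (c : Fin n → ZMod r) (σ : Equiv.Perm (Fin n)) :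
    C (chi ω a b (digitColoring (c, σ))) =
      (-1) ^ (a * (inversionCount (fun i => letterKey (σ i, c (σ i))) +
        ∑ d, if c d ≠ 0 then (d : ℕ) else 0)) * C (ω ^ b) ^ ∑ d, (c d).val := by
  rw [chi_eq, reducedLength, sum_colored_digitColoring, colorSum_digitColoring,
    keys_digitColoring, C_mul, pow_mul ω, C_pow (a := ω ^ b), C_pow, C_neg, C_1]

theorem sum_chi_mul_pow_length [NeZero r] (ω : ℂ) (a b : ℕ) :
    ∑ π : ColoredPerm r n, C (chi ω a b π) * (X : ℂ[X]) ^ π.length =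
      ∏ k ∈ Finset.Icc 1 n, qAnalogue k ((-1) ^ a * X) *
        (1 + (-1) ^ (a * (k + 1)) * C (ω ^ b) * X ^ k * qAnalogue (r - 1) (C (ω ^ b) * X)) := by
  rw [Finset.prod_mul_distrib, ← sum_prod_digitWeight, ← Equiv.sum_comp digitColoring,
    Fintype.sum_prod_type, Finset.mul_sum]
  refine Finset.sum_congr rfl fun c _ => ?_
  simp only [qAnalogue]
  rw [← sum_perm_pow_inversionCount_comp (letterKey_injective_digit c), Finset.sum_mul]
  refine Finset.sum_congr rfl fun σ _ => ?_
  rw [C_chi, length_eq, reducedLength, sum_colored_digitColoring, colorSum_digitColoring,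
    keys_digitColoring, prod_digitWeight]
  ring

theorem sum_chi_mul_pow_lmaj [NeZero r] (ω : ℂ) (a b : ℕ) :
    ∑ π : ColoredPerm r n, C (chi ω a b π) * (X : ℂ[X]) ^ π.lmaj =
      ∏ k ∈ Finset.Icc 1 n, qAnalogue k ((-1) ^ (a * (k - 1)) * X) *
        (1 + (-1) ^ (a * (k + 1)) * C (ω ^ b) * X ^ k * qAnalogue (r - 1) (C (ω ^ b) * X)) := by
  rw [Finset.prod_mul_distrib, ← sum_prod_digitWeight, ← Equiv.sum_comp digitColoring,
    Fintype.sum_prod_type, Finset.mul_sum]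
  refine Finset.sum_congr rfl fun c _ => ?_
  simp only [qAnalogue]
  rw [← sum_perm_pow_inversionCount_mul_pow_majorIndex_comp (letterKey_injective_digit c),
    Finset.sum_mul]
  -- The sign splits: `(-1) ^ (a * inv)` stays with the major index, and the part from the colored
  -- digits goes into `digitWeight`.
  refine Finset.sum_congr rfl fun σ _ => ?_
  rw [C_chi, lmaj_eq, sum_colored_digitColoring, colorSum_digitColoring, keys_digitColoring,
    prod_digitWeight]
  ring

end ColoredPerm

open Polynomial in
theorem mainTheorem1 (r n : ℕ) [NeZero r] (hn : 0 < n) (ω : ℂ) (hω : IsPrimitiveRoot ω r) :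
    (∀ ψ : ColoredPerm r n →* ℂˣ, ∃ a < 2, ∃ b < r,
      ∀ π : ColoredPerm r n, (ψ π : ℂ) = ColoredPerm.chi ω a b π) ∧
    ∀ a < 2, ∀ b < r,
      (∃ ψ : ColoredPerm r n →* ℂˣ,
        ∀ π : ColoredPerm r n, (ψ π : ℂ) = ColoredPerm.chi ω a b π) ∧
      (∑ π : ColoredPerm r n, C (ColoredPerm.chi ω a b π) * (X : ℂ[X]) ^ π.length =
        ∏ k ∈ Finset.Icc 1 n, qAnalogue k ((-1) ^ a * X) *
          (1 + (-1) ^ (a * (k + 1)) * C (ω ^ b) * X ^ k *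
            qAnalogue (r - 1) (C (ω ^ b) * X))) ∧
      (∑ π : ColoredPerm r n, C (ColoredPerm.chi ω a b π) * (X : ℂ[X]) ^ π.lmaj =
        ∏ k ∈ Finset.Icc 1 n, qAnalogue k ((-1) ^ (a * (k - 1)) * X) *
          (1 + (-1) ^ (a * (k + 1)) * C (ω ^ b) * X ^ k *
            qAnalogue (r - 1) (C (ω ^ b) * X))) := by
  refine ⟨fun ψ => ColoredPerm.exists_hom_eq_chi hn hω ((Units.coeHom ℂ).comp ψ),
    fun a _ b _ => ⟨⟨(ColoredPerm.chiHom hω.pow_eq_one a b).toHomUnits, fun π => ?_⟩,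
      ColoredPerm.sum_chi_mul_pow_length ω a b, ColoredPerm.sum_chi_mul_pow_lmaj ω a b⟩⟩
  rw [MonoidHom.coe_toHomUnits, ColoredPerm.chiHom_apply]
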